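/- Let $p,q$ be positive integers. Let $(\bar M,\bar g)$ be a semi-Riemannian manifold of dimension $m+n$ (smooth, with $\bar g$ of constant index), with Levi-Civita connection $\bar\nabla$, and let $\bar J$ be a smooth $(1,1)$-tensor field on $\bar M$ with $\bar J^2=p\bar J+qI$ and $\bar g(U,\bar JV)=\bar g(\bar JU,V)$; thus $(\bar M,\bar g,\bar J)$ is a metallic semi-Riemannian manifold. Let $\eta$ be a smooth vector field on $\bar M$, let $\pi(V)=\bar g(V,\eta)$, and let $\bar D$ be the quarter symmetric non-metric connection $\bar D_UV=\bar\nabla_UV+\pi(V)\bar JU$. Let $M$ be an $m$-dimensional immersed $r$-lightlike submanifold of $\bar M$: the radical distribution $Rad(TM)=TM\cap TM^\perp$ has constant rank $r>0$. Let $S(TM)$ be a smooth distribution complementary to $Rad(TM)$ in $TM$ (the screen distribution), let $S(TM^\perp)$ be a smooth bundle complementary to $Rad(TM)$ in $TM^\perp$, let $ltr(TM)$ be a smooth totally null bundle complementary to $Rad(TM)$ in $(S(TM)\oplus S(TM^\perp))^\perp$, and put $tr(TM)=ltr(TM)\oplus S(TM^\perp)$, so that $T\bar M|_M=TM\oplus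 tr(TM)$. For $U,V\in\Gamma(TM)$ let $D_UV$ be the $TM$-component of $\bar D_UV$ in this decomposition, and for $\xi\in\Gamma(Rad(TM))$ and $U\in\Gamma(TM)$ let $-\bar A^*_\xi U$ be the $S(TM)$-component of $D_U\xi$ in $TM=S(TM)\oplus Rad(TM)$. Suppose that $M$ is invariant, that is, $\bar J\,Rad(TM)=Rad(TM)$ and $\bar J\,S(TM)=S(TM)$. Then $Rad(TM)$ is integrable (that is, involutive: $[U,V]\in\Gamma(Rad(TM))$ for all $U,V\in\Gamma(Rad(TM))$) if and only if $$\bar A^*_{\bar JU}V-p\,\bar A^*_UV=\bar A^*_{\bar JV}U-p\,\bar A^*_VU\qquad\text{for all }U,V\in\Gamma(Rad(TM)).$$ -/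

import Mathlib

open Bundle Module Topology
open scoped Manifold ContDiff

noncomputable section

/-! ### Linear algebra of a lightlike subspace -/

namespace LightlikeAlgebra

variable {V : Type*} [AddCommGroup V] [Module ℝ V] [FiniteDimensional ℝ V]

/-- Let `B` be a nondegenerate symmetric bilinear form, `T` a subspace with radical
`R = T ∩ T^⊥`, and let `S`, `S'`, `L` be complements of `R` in `T`, in `T^⊥` and in
`S^⊥ ∩ S'^⊥` respectively. Then `L ⊕ S'` is a complement of `T` in `V`. -/
theorem isCompl_transversal (B : LinearMap.BilinForm ℝ V) (hB : B.Nondegenerate)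
    (hs : B.IsSymm) (T R S S' L : Submodule ℝ V) (hR : R = T ⊓ B.orthogonal T)
    (hS : S ⊔ R = T) (hS₀ : S ⊓ R = ⊥) (hS' : S' ⊔ R = B.orthogonal T) (hS'₀ : S' ⊓ R = ⊥)
    (hL : L ⊔ R = B.orthogonal S ⊓ B.orthogonal S') (hL₀ : L ⊓ R = ⊥) :
    IsCompl T (L ⊔ S') := by
  have hrefl : B.IsRefl := hs.isRefl
  have ho : ∀ {W : Submodule ℝ V} {v : V}, v ∈ B.orthogonal W ↔ ∀ w ∈ W, B w v = 0 := Iff.rfl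
  have hRT : R ≤ T := hR ▸ inf_le_left
  have hRT' : R ≤ B.orthogonal T := hR ▸ inf_le_right
  have hS'T' : S' ≤ B.orthogonal T := hS' ▸ le_sup_left
  have hLS : L ≤ B.orthogonal S ⊓ B.orthogonal S' := hL ▸ le_sup_left
  have hdisj : Disjoint T (L ⊔ S') := by
    rw [Submodule.disjoint_def]
    intro t ht hls
    obtain ⟨l, hl, s', hs', rfl⟩ := Submodule.mem_sup.1 hls
    have hlR : ∀ r ∈ R, B r l = 0 := by
      intro r hr
      have h1 : B r (l + s') = 0 := hrefl _ _ (ho.1 (hRT' hr) _ ht)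
      have h2 : B r s' = 0 := ho.1 (hS'T' hs') _ (hRT hr)
      simpa [h2] using h1
    have hlT : l ∈ B.orthogonal T := by
      rw [ho, ← hS]
      intro w hw
      obtain ⟨a, ha, b, hb, rfl⟩ := Submodule.mem_sup.1 hw
      have := ho.1 (hLS hl).1 _ ha
      simp [this, hlR b hb]
    have hlT' : l ∈ B.orthogonal (B.orthogonal T) := by
      rw [ho, ← hS']
      intro w hw
      obtain ⟨a, ha, b, hb, rfl⟩ := Submodule.mem_sup.1 hw
      have := ho.1 (hLS hl).2 _ ha
      simp [this, hlR b hb]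
    rw [LinearMap.BilinForm.orthogonal_orthogonal hB hrefl] at hlT'
    have hl0 : l = 0 := by
      have : l ∈ L ⊓ R := ⟨hl, by rw [hR]; exact ⟨hlT', hlT⟩⟩
      rw [hL₀] at this
      simpa using this
    subst hl0
    have : s' ∈ S' ⊓ R := ⟨hs', by rw [hR]; exact ⟨by simpa using ht, hS'T' hs'⟩⟩
    rw [hS'₀] at this
    simpa using this
  refine ⟨hdisj, codisjoint_iff.2 ?_⟩
  apply Submodule.eq_top_of_finrank_eq
  have f1 := Submodule.finrank_sup_add_finrank_inf_eq S R
  have f2 := Submodule.finrank_sup_add_finrank_inf_eq S' R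
  have f3 := Submodule.finrank_sup_add_finrank_inf_eq L R
  have f4 := Submodule.finrank_sup_add_finrank_inf_eq T (L ⊔ S')
  have f5 := LinearMap.BilinForm.finrank_orthogonal hB T
  have f6 := Submodule.finrank_le T
  have hLS' : L ⊓ S' = ⊥ := by
    rw [eq_bot_iff]
    rintro v ⟨hvl, hvs⟩
    have hvT : v ∈ B.orthogonal (B.orthogonal T) := by
      rw [ho, ← hS']
      intro w hw
      obtain ⟨a, ha, b, hb, rfl⟩ := Submodule.mem_sup.1 hw
      have h1 := ho.1 (hLS hvl).2 _ ha
      have h2 := ho.1 (hS'T' hvs) _ (hRT hb)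
      simp [h1, h2]
    rw [LinearMap.BilinForm.orthogonal_orthogonal hB hrefl] at hvT
    have : v ∈ S' ⊓ R := ⟨hvs, by rw [hR]; exact ⟨hvT, hS'T' hvs⟩⟩
    rwa [hS'₀] at this
  have f7 := Submodule.finrank_sup_add_finrank_inf_eq L S'
  have hSS' : S ⊓ S' = ⊥ := by
    rw [eq_bot_iff]
    rintro v ⟨hvs, hvs'⟩
    have : v ∈ S ⊓ R := ⟨hvs, by rw [hR]; exact ⟨hS ▸ (le_sup_left : S ≤ S ⊔ R) hvs, hS'T' hvs'⟩⟩
    rwa [hS₀] at this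
  have f8 := Submodule.finrank_sup_add_finrank_inf_eq S S'
  have hsup : B.orthogonal (S ⊔ S') = B.orthogonal S ⊓ B.orthogonal S' := by
    apply le_antisymm
    · exact le_inf (LinearMap.BilinForm.orthogonal_le le_sup_left)
        (LinearMap.BilinForm.orthogonal_le le_sup_right)
    · rintro v ⟨h1, h2⟩
      rw [ho]
      intro w hw
      obtain ⟨a, ha, b, hb, rfl⟩ := Submodule.mem_sup.1 hw
      simp [ho.1 h1 _ ha, ho.1 h2 _ hb]
  have f9 := LinearMap.BilinForm.finrank_orthogonal hB (S ⊔ S')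
  have f10 := Submodule.finrank_le (S ⊔ S')
  rw [hsup, ← hL] at f9
  rw [hS, hS₀] at f1
  rw [hS', hS'₀] at f2
  rw [hL₀] at f3
  rw [hdisj.eq_bot] at f4
  rw [hLS'] at f7
  rw [hSS'] at f8
  simp only [finrank_bot] at f1 f2 f3 f4 f7 f8
  omega

end LightlikeAlgebra

/-! ### Metallic semi-Riemannian manifolds -/

section Ambient

variable {k : ℕ} {N : Type*} [TopologicalSpace N] [ChartedSpace (EuclideanSpace ℝ (Fin k)) N]
  [IsManifold (𝓡 k) ∞ N]

variable (k N) in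
/-- A semi-Riemannian metric: a smooth symmetric nondegenerate `(0,2)`-tensor field of constant
index. -/
structure SemiRiemannianMetric where
  inner (x : N) : TangentSpace (𝓡 k) x →L[ℝ] TangentSpace (𝓡 k) x →L[ℝ] ℝ
  symm (x : N) (v w : TangentSpace (𝓡 k) x) : inner x v w = inner x w v
  nondegenerate (x : N) (v : TangentSpace (𝓡 k) x) (hv : ∀ w, inner x v w = 0) : v = 0
  contMDiff : ContMDiff (𝓡 k)
    ((𝓡 k).prod 𝓘(ℝ, EuclideanSpace ℝ (Fin k) →L[ℝ] EuclideanSpace ℝ (Fin k) →L[ℝ] ℝ)) ∞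
    (fun x ↦ TotalSpace.mk'
      (EuclideanSpace ℝ (Fin k) →L[ℝ] EuclideanSpace ℝ (Fin k) →L[ℝ] ℝ) x (inner x))
  index : ℕ
  /-- At every point, `index` is the largest dimension of a negative definite subspace. -/
  isGreatest_index (x : N) : IsGreatest
    {i : ℕ | ∃ W : Submodule ℝ (TangentSpace (𝓡 k) x),
      finrank ℝ W = i ∧ ∀ w ∈ W, w ≠ 0 → inner x w w < 0} index

namespace SemiRiemannianMetric

/-- The metric at a point, as a bilinear form. -/
def bilin (g : SemiRiemannianMetric k N) (x : N) :
    LinearMap.BilinForm ℝ (TangentSpace (𝓡 k) x) :=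
  (g.inner x).toBilinForm

theorem bilin_apply (g : SemiRiemannianMetric k N) (x : N) (v w : TangentSpace (𝓡 k) x) :
    g.bilin x v w = g.inner x v w := rfl

theorem bilin_isSymm (g : SemiRiemannianMetric k N) (x : N) : (g.bilin x).IsSymm :=
  ⟨fun v w ↦ g.symm x v w⟩

theorem bilin_nondegenerate (g : SemiRiemannianMetric k N) (x : N) :
    (g.bilin x).Nondegenerate :=
  ⟨fun v hv ↦ g.nondegenerate x v hv,
    fun v hv ↦ g.nondegenerate x v fun w ↦ (g.symm x v w).trans (hv w)⟩

end SemiRiemannianMetric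

/-- The connection `cov` is the Levi-Civita connection of `g`: it is torsion-free and `g` is
parallel. Here `cov Y x u` is the derivative `∇_u Y` at the point `x`. -/
structure IsLeviCivita (g : SemiRiemannianMetric k N)
    (cov : CovariantDerivative (𝓡 k) (EuclideanSpace ℝ (Fin k))
      (TangentSpace (𝓡 k) : N → Type _)) : Prop where
  torsion_eq_zero : cov.torsion = 0
  metric {Y Z : Π x : N, TangentSpace (𝓡 k) x} {x : N}
    (hY : MDifferentiableAt (𝓡 k) (𝓡 k).tangent
      (fun y ↦ (⟨y, Y y⟩ : TangentBundle (𝓡 k) N)) x)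
    (hZ : MDifferentiableAt (𝓡 k) (𝓡 k).tangent
      (fun y ↦ (⟨y, Z y⟩ : TangentBundle (𝓡 k) N)) x)
    (u : TangentSpace (𝓡 k) x) :
    mvfderiv (𝓡 k) (fun y ↦ g.inner y (Y y) (Z y)) x u =
      g.inner x (cov Y x u) (Z x) + g.inner x (Y x) (cov Z x u)

/-- A metallic structure on `(N, g)` with parameters `p`, `q`: a smooth `(1,1)`-tensor field `J`
with `J² = p J + q I`, such that `g` is `J`-compatible. -/
structure MetallicStructure (g : SemiRiemannianMetric k N) (p q : ℕ) where
  toFun (x : N) : TangentSpace (𝓡 k) x →L[ℝ] TangentSpace (𝓡 k) x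
  contMDiff : ContMDiff (𝓡 k)
    ((𝓡 k).prod 𝓘(ℝ, EuclideanSpace ℝ (Fin k) →L[ℝ] EuclideanSpace ℝ (Fin k))) ∞
    (fun x ↦ TotalSpace.mk'
      (EuclideanSpace ℝ (Fin k) →L[ℝ] EuclideanSpace ℝ (Fin k)) x (toFun x))
  sq (x : N) (v : TangentSpace (𝓡 k) x) :
    toFun x (toFun x v) = (p : ℝ) • toFun x v + (q : ℝ) • v
  compatible (x : N) (v w : TangentSpace (𝓡 k) x) :
    g.inner x v (toFun x w) = g.inner x (toFun x v) w

/-- The quarter symmetric non-metric connection `D_U V = ∇_U V + π(V) J U`, where `π` is the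
1-form `π(V) = g(V, η)`. -/
def quarterSymmetricConnection {g : SemiRiemannianMetric k N} {p q : ℕ}
    (J : MetallicStructure g p q) (η : Π x : N, TangentSpace (𝓡 k) x)
    (cov : CovariantDerivative (𝓡 k) (EuclideanSpace ℝ (Fin k))
      (TangentSpace (𝓡 k) : N → Type _)) :
    CovariantDerivative (𝓡 k) (EuclideanSpace ℝ (Fin k)) (TangentSpace (𝓡 k) : N → Type _) :=
  cov.addOneForm fun x ↦ (g.inner x (η x)).smulRight (J.toFun x)

theorem quarterSymmetricConnection_apply {g : SemiRiemannianMetric k N} {p q : ℕ}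
    (J : MetallicStructure g p q) (η : Π x : N, TangentSpace (𝓡 k) x)
    (cov : CovariantDerivative (𝓡 k) (EuclideanSpace ℝ (Fin k))
      (TangentSpace (𝓡 k) : N → Type _))
    (U V : Π x : N, TangentSpace (𝓡 k) x) (x : N) :
    quarterSymmetricConnection J η cov V x (U x) =
      cov V x (U x) + g.inner x (V x) (η x) • J.toFun x (U x) := by
  rw [g.symm]
  rfl

end Ambient

/-! ### Submanifolds -/

section Submanifold

variable {m k : ℕ}
  {M : Type*} [TopologicalSpace M] [ChartedSpace (EuclideanSpace ℝ (Fin m)) M]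
  {N : Type*} [TopologicalSpace N] [ChartedSpace (EuclideanSpace ℝ (Fin k)) N]
  [IsManifold (𝓡 k) ∞ N]

/-- The covariant derivative of a vector field `X` along a map `φ : M → N` (the pullback
connection on `φ^* TN`): in the trivialization of `TN` at `φ x`, the derivative of the components
of `X` plus the derivative of the frame field with the same constant components as `X x`. -/
def CovariantDerivative.along
    (cov : CovariantDerivative (𝓡 k) (EuclideanSpace ℝ (Fin k))
      (TangentSpace (𝓡 k) : N → Type _))
    (φ : M → N) (X : Π x : M, TangentSpace (𝓡 k) (φ x)) (x : M) :
    TangentSpace (𝓡 m) x →L[ℝ] TangentSpace (𝓡 k) (φ x) :=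
  let e := trivializationAt (EuclideanSpace ℝ (Fin k)) (TangentSpace (𝓡 k) : N → Type _) (φ x)
  e.symmL ℝ (φ x) ∘L
      mvfderiv (𝓡 m) (fun y ↦ (e (⟨φ y, X y⟩ : TangentBundle (𝓡 k) N)).2) x +
    cov (FiberBundle.extend (EuclideanSpace ℝ (Fin k)) (X x)) (φ x) ∘L mfderiv (𝓡 m) (𝓡 k) φ x

/-- A family of subspaces `W x ⊆ T_{φ x} N` is a smooth subbundle of `φ^* TN`: locally it has a
frame of smooth sections. For `φ = id` this is a smooth distribution on `N`. -/
def IsSmoothSubbundle (φ : M → N) (W : Π x : M, Submodule ℝ (TangentSpace (𝓡 k) (φ x))) : Prop :=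
  ∀ x₀ : M, ∃ O ∈ 𝓝 x₀, ∃ (d : ℕ) (X : Fin d → Π x : M, TangentSpace (𝓡 k) (φ x)),
    (∀ i, ContMDiffOn (𝓡 m) (𝓡 k).tangent ∞
      (fun x ↦ (⟨φ x, X i x⟩ : TangentBundle (𝓡 k) N)) O) ∧
    ∀ x ∈ O, LinearIndependent ℝ (fun i ↦ X i x) ∧
      Submodule.span ℝ (Set.range fun i ↦ X i x) = W x

variable (m) in
/-- The tangent space of the immersed manifold, as a subspace of `T_{φ x} N`. -/
def tangentImage (φ : M → N) (x : M) : Submodule ℝ (TangentSpace (𝓡 k) (φ x)) :=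
  LinearMap.range (mfderiv (𝓡 m) (𝓡 k) φ x).toLinearMap

/-- The radical `Rad(TM)` at `x`: the `v ∈ T_x M` which are orthogonal to `T_x M`. -/
def radical (g : SemiRiemannianMetric k N) (φ : M → N) (x : M) :
    Submodule ℝ (TangentSpace (𝓡 m) x) :=
  ((g.bilin (φ x)).orthogonal (tangentImage m φ x)).comap
    (mfderiv (𝓡 m) (𝓡 k) φ x).toLinearMap

variable [IsManifold (𝓡 m) ∞ M]

variable (m M) in
/-- An `r`-lightlike submanifold `(M, g, S(TM), S(TM^⊥))` of `(N, g)`, immersed by `φ`, with a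
lightlike transversal bundle. `Rad(TM)` has constant rank `r > 0` (so it is a smooth
distribution); `S(TM)` complements it in `TM`, `S(TM^⊥)` complements it in `TM^⊥`, and `ltr(TM)`
is totally null and complements it in the orthogonal complement of `S(TM) ⊕ S(TM^⊥)`. -/
structure LightlikeSubmanifold (g : SemiRiemannianMetric k N) (r : ℕ) where
  φ : M → N
  contMDiff : ContMDiff (𝓡 m) (𝓡 k) ∞ φ
  injective_mfderiv (x : M) : Function.Injective (mfderiv (𝓡 m) (𝓡 k) φ x)
  rank_pos : 0 < r
  finrank_radical (x : M) : finrank ℝ (radical (m := m) g φ x) = r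
  /-- `S(TM)` -/
  screen (x : M) : Submodule ℝ (TangentSpace (𝓡 m) x)
  isSmooth_screen : IsSmoothSubbundle (m := m) (k := m) (id : M → M) screen
  screen_sup (x : M) : screen x ⊔ radical g φ x = ⊤
  screen_inf (x : M) : screen x ⊓ radical g φ x = ⊥
  /-- `S(TM^⊥)` -/
  screenTransversal (x : M) : Submodule ℝ (TangentSpace (𝓡 k) (φ x))
  isSmooth_screenTransversal : IsSmoothSubbundle (m := m) φ screenTransversal
  screenTransversal_sup (x : M) :
    screenTransversal x ⊔ (radical g φ x).map (mfderiv (𝓡 m) (𝓡 k) φ x).toLinearMap =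
      (g.bilin (φ x)).orthogonal (tangentImage m φ x)
  screenTransversal_inf (x : M) :
    screenTransversal x ⊓ (radical g φ x).map (mfderiv (𝓡 m) (𝓡 k) φ x).toLinearMap = ⊥
  /-- `ltr(TM)` -/
  ltr (x : M) : Submodule ℝ (TangentSpace (𝓡 k) (φ x))
  isSmooth_ltr : IsSmoothSubbundle (m := m) φ ltr
  ltr_sup (x : M) :
    ltr x ⊔ (radical g φ x).map (mfderiv (𝓡 m) (𝓡 k) φ x).toLinearMap =
      (g.bilin (φ x)).orthogonal ((screen x).map (mfderiv (𝓡 m) (𝓡 k) φ x).toLinearMap) ⊓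
        (g.bilin (φ x)).orthogonal (screenTransversal x)
  ltr_inf (x : M) :
    ltr x ⊓ (radical g φ x).map (mfderiv (𝓡 m) (𝓡 k) φ x).toLinearMap = ⊥
  ltr_null (x : M) : ∀ v ∈ ltr x, ∀ w ∈ ltr x, g.inner (φ x) v w = 0

namespace LightlikeSubmanifold

variable {g : SemiRiemannianMetric k N} {r : ℕ} (L : LightlikeSubmanifold m M g r)

/-- The differential of the immersion. -/
def dφ (x : M) : TangentSpace (𝓡 m) x →L[ℝ] TangentSpace (𝓡 k) (L.φ x) :=
  mfderiv (𝓡 m) (𝓡 k) L.φ x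

/-- `Rad(TM)`. -/
def rad (x : M) : Submodule ℝ (TangentSpace (𝓡 m) x) := radical g L.φ x

/-- `tr(TM) = ltr(TM) ⊕ S(TM^⊥)`. -/
def tr (x : M) : Submodule ℝ (TangentSpace (𝓡 k) (L.φ x)) := L.ltr x ⊔ L.screenTransversal x

theorem isCompl_screen (x : M) : IsCompl (L.screen x) (L.rad x) :=
  ⟨disjoint_iff.2 (L.screen_inf x), codisjoint_iff.2 (L.screen_sup x)⟩

theorem map_rad (x : M) :
    (radical g L.φ x).map (mfderiv (𝓡 m) (𝓡 k) L.φ x).toLinearMap =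
      tangentImage m L.φ x ⊓ (g.bilin (L.φ x)).orthogonal (tangentImage m L.φ x) := by
  rw [radical, Submodule.map_comap_eq, tangentImage]

/-- `TN|_M = TM ⊕ tr(TM)`. -/
theorem isCompl_tr (x : M) : IsCompl (tangentImage m L.φ x) (L.tr x) := by
  have : FiniteDimensional ℝ (TangentSpace (𝓡 k) (L.φ x)) :=
    inferInstanceAs (FiniteDimensional ℝ (EuclideanSpace ℝ (Fin k)))
  refine LightlikeAlgebra.isCompl_transversal (g.bilin (L.φ x)) (g.bilin_nondegenerate _)
    (g.bilin_isSymm _) (tangentImage m L.φ x)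
    ((radical g L.φ x).map (mfderiv (𝓡 m) (𝓡 k) L.φ x).toLinearMap)
    ((L.screen x).map (mfderiv (𝓡 m) (𝓡 k) L.φ x).toLinearMap)
    (L.screenTransversal x) (L.ltr x) (L.map_rad x) ?_ ?_ (L.screenTransversal_sup x)
    (L.screenTransversal_inf x) (L.ltr_sup x) (L.ltr_inf x)
  · rw [← Submodule.map_sup, L.screen_sup, Submodule.map_top, tangentImage]
  · rw [← Submodule.map_inf _ (L.injective_mfderiv x), L.screen_inf, Submodule.map_bot]

/-- The tangential part of a vector of `T_{φ x} N`, with respect to `TN|_M = TM ⊕ tr(TM)`. -/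
def tangentialPart (x : M) : TangentSpace (𝓡 k) (L.φ x) →ₗ[ℝ] TangentSpace (𝓡 m) x :=
  (LinearEquiv.ofInjective (mfderiv (𝓡 m) (𝓡 k) L.φ x).toLinearMap
    (L.injective_mfderiv x)).symm.toLinearMap ∘ₗ
    (tangentImage m L.φ x).projectionOnto (L.tr x) (L.isCompl_tr x)

/-- The connection `D` induced on `M` by a connection `Dbar` of the ambient manifold: `D_u V` is
the tangential part of `Dbar_u V` (Gauss formula). -/
def inducedConnection
    (Dbar : CovariantDerivative (𝓡 k) (EuclideanSpace ℝ (Fin k))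
      (TangentSpace (𝓡 k) : N → Type _))
    (V : Π x : M, TangentSpace (𝓡 m) x) (x : M) (u : TangentSpace (𝓡 m) x) :
    TangentSpace (𝓡 m) x :=
  L.tangentialPart x (Dbar.along L.φ (fun y ↦ L.dφ y (V y)) x u)

/-- The shape operator `A^*_ξ u` of the screen distribution, for a section `ξ` of `Rad(TM)`: in
`D_u ξ = -A^*_ξ u + ∇^{*t}_u ξ` the first term is the component in `S(TM)` and the second one the
component in `Rad(TM)`. -/
def screenShape
    (Dbar : CovariantDerivative (𝓡 k) (EuclideanSpace ℝ (Fin k))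
      (TangentSpace (𝓡 k) : N → Type _))
    (ξ : Π x : M, TangentSpace (𝓡 m) x) (x : M) (u : TangentSpace (𝓡 m) x) :
    TangentSpace (𝓡 m) x :=
  -(L.screen x).projection (L.rad x) (L.isCompl_screen x) (L.inducedConnection Dbar ξ x u)

/-- Smooth sections of `Rad(TM)`. -/
def IsRadSection (U : Π x : M, TangentSpace (𝓡 m) x) : Prop :=
  ContMDiff (𝓡 m) (𝓡 m).tangent ∞ (fun x ↦ (⟨x, U x⟩ : TangentBundle (𝓡 m) M)) ∧
    ∀ x, U x ∈ L.rad x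

/-- `Rad(TM)` is integrable (involutive): it is closed under the Lie bracket of vector fields. -/
def IsRadIntegrable : Prop :=
  ∀ U V : Π x : M, TangentSpace (𝓡 m) x, L.IsRadSection U → L.IsRadSection V →
    ∀ x, VectorField.mlieBracket (𝓡 m) U V x ∈ L.rad x

variable {p q : ℕ} (J : MetallicStructure g p q)

/-- `M` is an invariant lightlike submanifold: `J Rad(TM) = Rad(TM)` and `J S(TM) = S(TM)`. -/
def IsInvariant : Prop :=
  (∀ x, ((L.rad x).map (L.dφ x).toLinearMap).map (J.toFun (L.φ x)).toLinearMap =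
    (L.rad x).map (L.dφ x).toLinearMap) ∧
  ∀ x, ((L.screen x).map (L.dφ x).toLinearMap).map (J.toFun (L.φ x)).toLinearMap =
    (L.screen x).map (L.dφ x).toLinearMap

/-- The vector field on `M` which is the tangential part of `J U`; on an invariant lightlike
submanifold it is `J U` itself. -/
def tangentialJ (U : Π x : M, TangentSpace (𝓡 m) x) (x : M) : TangentSpace (𝓡 m) x :=
  L.tangentialPart x (J.toFun (L.φ x) (L.dφ x (U x)))

end LightlikeSubmanifold

end Submanifold

end

/-! Write P for the projection of TM onto S(TM) along Rad(TM), and β(U, V) = P[U, V] for sections U,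
V of Rad(TM); integrability says β = 0. The Koszul formula expresses 2 g(∇_U V, Z), for Z tangent to
M, through derivatives of the metric and brackets. Every term except g([U, V], Z) pairs a section of
Rad(TM) with a tangent field and so vanishes (`two_mul_inner_along`). The extra term π(V) J U of the
quarter symmetric connection lies in Rad(TM) by invariance and is orthogonal to TM. Since the metric
is nondegenerate on S(TM), A*_V U = -½ β(U, V) (`IsInvariant.screenShape_eq`).

If β = 0, all terms of the identity vanish. Conversely, by antisymmetry of β the identity reads
β(JU, V) + β(U, JV) = 2p β(U, V). Applied to the pair (JU, JV), with J² = pJ + q, it gives q (β(U,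
JV) + β(JU, V)) = 0, the terms in β(JU, JV) cancelling. Together these give 2pq β(U, V) = 0, and pq
≠ 0.

The Koszul formula needs the connection pulled back along the immersion to be metric
(`IsLeviCivita.mvfderiv_inner_along`) and torsion-free (`CovariantDerivative.along_mfderiv_sub`);
both are checked in trivializations. -/

/-! ### Lie brackets and differentials of vector-valued functions. -/

section Bracket

open VectorField

/-- The second-derivative terms of `f` cancel by symmetry; only the derivatives of the fields
remain. -/
theorem fderiv_lieBracket {E F : Type*} [NormedAddCommGroup E] [NormedSpace ℝ E]
    [NormedAddCommGroup F] [NormedSpace ℝ F] {f : E → F} {U V : E → E} {x : E}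
    (hf : ContDiffAt ℝ 2 f x) (hU : DifferentiableAt ℝ U x) (hV : DifferentiableAt ℝ V x) :
    fderiv ℝ f x (lieBracket ℝ U V x) =
      fderiv ℝ (fun y ↦ fderiv ℝ f y (V y)) x (U x) -
        fderiv ℝ (fun y ↦ fderiv ℝ f y (U y)) x (V x) := by
  have hf' : DifferentiableAt ℝ (fderiv ℝ f) x :=
    (hf.fderiv_right (m := 1) (by norm_num)).differentiableAt (by norm_num)
  have hsymm : IsSymmSndFDerivAt ℝ f x := hf.isSymmSndFDerivAt (by simp)
  rw [fderiv_clm_apply hf' hV, fderiv_clm_apply hf' hU, lieBracket]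
  simp [hsymm (U x) (V x)]

variable {m : ℕ} {M : Type*} [TopologicalSpace M] [ChartedSpace (EuclideanSpace ℝ (Fin m)) M]
  {F : Type*} [NormedAddCommGroup F] [NormedSpace ℝ F]

theorem MDifferentiableAt.mvfderiv_eq_fderiv {h : M → F} {x : M}
    (hh : MDifferentiableAt (𝓡 m) 𝓘(ℝ, F) h x) :
    mvfderiv (𝓡 m) h x = fderiv ℝ (h ∘ (extChartAt (𝓡 m) x).symm) (extChartAt (𝓡 m) x x) := by
  rw [hh.mvfderiv]
  simp [writtenInExtChartAt]
  rfl

theorem contDiffAt_comp_extChartAt_symm {f : M → F} {x : M} {k : ℕ}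
    (hf : ContMDiffAt (𝓡 m) 𝓘(ℝ, F) k f x) :
    ContDiffAt ℝ k (f ∘ (extChartAt (𝓡 m) x).symm) (extChartAt (𝓡 m) x x) := by
  have := (contMDiffAt_iff.1 hf).2
  rw [(𝓡 m).range_eq_univ] at this
  exact contDiffWithinAt_univ.1 this

variable [IsManifold (𝓡 m) ∞ M]

/-- The representation of a vector field in the chart at `x`. -/
noncomputable def chartField (V : Π x : M, TangentSpace (𝓡 m) x) (x : M) :
    EuclideanSpace ℝ (Fin m) → EuclideanSpace ℝ (Fin m) :=
  mpullbackWithin 𝓘(ℝ, EuclideanSpace ℝ (Fin m)) (𝓡 m) (extChartAt (𝓡 m) x).symm V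
    (Set.range (𝓡 m))

/-- No Jacobian factor appears: the tangent space at `x` is modelled through the chart at `x`, whose
differential there is the identity. -/
theorem chartField_self (V : Π x : M, TangentSpace (𝓡 m) x) (x : M) :
    chartField V x (extChartAt (𝓡 m) x x) = V x := by
  rw [chartField, mpullbackWithin_apply, mfderivWithin_range_extChartAt_symm]
  have : (extChartAt (𝓡 m) x).symm (extChartAt (𝓡 m) x x) = x := extChartAt_to_inv x
  erw [ContinuousLinearMap.inverse_id]
  change V ((extChartAt (𝓡 m) x).symm (extChartAt (𝓡 m) x x)) = V x
  rw [this]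

theorem differentiableAt_chartField {V : Π x : M, TangentSpace (𝓡 m) x} {x : M}
    (hV : MDifferentiableAt (𝓡 m) (𝓡 m).tangent (fun y ↦ (⟨y, V y⟩ : TangentBundle (𝓡 m) M)) x) :
    DifferentiableAt ℝ (chartField V x) (extChartAt (𝓡 m) x x) := by
  have := (mdifferentiableWithinAt_univ.2 hV).differentiableWithinAt_mpullbackWithin_vectorField
  have hr : (extChartAt (𝓡 m) x).symm ⁻¹' Set.univ ∩ Set.range (𝓡 m) = Set.univ := by simp
  rw [hr] at this
  exact differentiableWithinAt_univ.1 this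

theorem mlieBracket_eq_lieBracket_chartField (U V : Π x : M, TangentSpace (𝓡 m) x) (x : M) :
    mlieBracket (𝓡 m) U V x =
      lieBracket ℝ (chartField U x) (chartField V x) (extChartAt (𝓡 m) x x) := by
  rw [← mlieBracketWithin_univ, mlieBracketWithin_apply, mfderiv_extChartAt_self]
  have hr : (extChartAt (𝓡 m) x).symm ⁻¹' Set.univ ∩ Set.range (𝓡 m) = Set.univ := by simp
  erw [ContinuousLinearMap.inverse_id]
  rw [hr]
  exact congrFun (lieBracketWithin_univ (𝕜 := ℝ) (V := chartField U x) (W := chartField V x)) _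

theorem mvfderiv_chartField {f : M → F} {x : M} {z : EuclideanSpace ℝ (Fin m)}
    (hz : z ∈ (extChartAt (𝓡 m) x).target)
    (hf : MDifferentiableAt (𝓡 m) 𝓘(ℝ, F) f ((extChartAt (𝓡 m) x).symm z))
    (V : Π x : M, TangentSpace (𝓡 m) x) :
    fderiv ℝ (f ∘ (extChartAt (𝓡 m) x).symm) z (chartField V x z) =
      mvfderiv (𝓡 m) f ((extChartAt (𝓡 m) x).symm z) (V ((extChartAt (𝓡 m) x).symm z)) := by
  have hs := mdifferentiableWithinAt_extChartAt_symm hz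
  have hc := mfderiv_comp_mfderivWithin z hf hs ((𝓡 m).uniqueMDiffOn z (by simp))
  have hi := isInvertible_mfderivWithin_extChartAt_symm hz
  have h1 : fderiv ℝ (f ∘ (extChartAt (𝓡 m) x).symm) z =
      mfderivWithin 𝓘(ℝ, EuclideanSpace ℝ (Fin m)) 𝓘(ℝ, F) (f ∘ (extChartAt (𝓡 m) x).symm)
        (Set.range (𝓡 m)) z := by
    simp
  rw [h1, hc, chartField, mpullbackWithin_apply]
  have := hi.self_apply_inverse (V ((extChartAt (𝓡 m) x).symm z))
  change mfderiv (𝓡 m) 𝓘(ℝ, F) f _ (mfderivWithin _ _ _ _ _ _) = mfderiv (𝓡 m) 𝓘(ℝ, F) f _ _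
  erw [this]

/-- The differential of a function is compatible with Lie brackets: `df [U, V] = U(df V) - V(df U)`
in a vector space. -/
theorem mvfderiv_mlieBracket {f : M → F} {x : M} (hf : ContMDiffAt (𝓡 m) 𝓘(ℝ, F) 2 f x)
    {U V : Π x : M, TangentSpace (𝓡 m) x}
    (hU : MDifferentiableAt (𝓡 m) (𝓡 m).tangent (fun y ↦ (⟨y, U y⟩ : TangentBundle (𝓡 m) M)) x)
    (hV : MDifferentiableAt (𝓡 m) (𝓡 m).tangent (fun y ↦ (⟨y, V y⟩ : TangentBundle (𝓡 m) M)) x)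
    (hfU : MDifferentiableAt (𝓡 m) 𝓘(ℝ, F) (fun y ↦ mvfderiv (𝓡 m) f y (U y)) x)
    (hfV : MDifferentiableAt (𝓡 m) 𝓘(ℝ, F) (fun y ↦ mvfderiv (𝓡 m) f y (V y)) x) :
    mvfderiv (𝓡 m) f x (mlieBracket (𝓡 m) U V x) =
      mvfderiv (𝓡 m) (fun y ↦ mvfderiv (𝓡 m) f y (V y)) x (U x) -
        mvfderiv (𝓡 m) (fun y ↦ mvfderiv (𝓡 m) f y (U y)) x (V x) := by
  -- Both sides get differentiated at the centre of the chart, so they must agree on a neighbourhood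
  -- and not only at the point.
  have key (W : Π x : M, TangentSpace (𝓡 m) x) :
      (fun y ↦ mvfderiv (𝓡 m) f y (W y)) ∘ (extChartAt (𝓡 m) x).symm
        =ᶠ[𝓝 (extChartAt (𝓡 m) x x)]
      fun z ↦ fderiv ℝ (f ∘ (extChartAt (𝓡 m) x).symm) z (chartField W x z) := by
    have h1 : ∀ᶠ y in 𝓝 x, ContMDiffAt (𝓡 m) 𝓘(ℝ, F) 2 f y :=
      (contMDiffAt_iff_contMDiffAt_nhds (by simp)).1 hf
    have h2 := (continuousAt_extChartAt_symm (I := 𝓡 m) x).eventually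
      (p := fun y ↦ ContMDiffAt (𝓡 m) 𝓘(ℝ, F) 2 f y) (by rwa [extChartAt_to_inv])
    filter_upwards [h2, extChartAt_target_mem_nhds (I := 𝓡 m) x] with z hz hz'
    exact (mvfderiv_chartField hz' (hz.mdifferentiableAt (by simp)) W).symm
  rw [(hf.mdifferentiableAt (by simp)).mvfderiv_eq_fderiv, hfU.mvfderiv_eq_fderiv,
    hfV.mvfderiv_eq_fderiv, (key U).fderiv_eq, (key V).fderiv_eq,
    mlieBracket_eq_lieBracket_chartField]
  have := fderiv_lieBracket (contDiffAt_comp_extChartAt_symm (k := 2) hf)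
    (differentiableAt_chartField hU) (differentiableAt_chartField hV)
  erw [this, chartField_self, chartField_self]
  rfl

end Bracket

/-! ### Metric compatibility of the pulled-back connection. -/

section Pullback

open ContinuousLinearMap VectorField

variable {k : ℕ} {N : Type*} [TopologicalSpace N] [ChartedSpace (EuclideanSpace ℝ (Fin k)) N]
  {m : ℕ} {M : Type*} [TopologicalSpace M] [ChartedSpace (EuclideanSpace ℝ (Fin m)) M]
  {F : Type*} [NormedAddCommGroup F] [NormedSpace ℝ F]

theorem Filter.EventuallyEq.mvfderiv_apply_eq {f h : M → F} {x : M} (hfh : f =ᶠ[𝓝 x] h)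
    (u : TangentSpace (𝓡 m) x) : mvfderiv (𝓡 m) f x u = mvfderiv (𝓡 m) h x u := by
  change mfderiv (𝓡 m) 𝓘(ℝ, F) f x u = mfderiv (𝓡 m) 𝓘(ℝ, F) h x u
  rw [hfh.mfderiv_eq]
  rfl

theorem mvfderiv_comp_mfderiv {f : N → F} {φ : M → N} {x : M}
    (hf : MDifferentiableAt (𝓡 k) 𝓘(ℝ, F) f (φ x)) (hφ : MDifferentiableAt (𝓡 m) (𝓡 k) φ x)
    (u : TangentSpace (𝓡 m) x) :
    mvfderiv (𝓡 m) (fun y ↦ f (φ y)) x u =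
      mvfderiv (𝓡 k) f (φ x) (mfderiv (𝓡 m) (𝓡 k) φ x u) :=
  mfderiv_comp_apply x hf hφ u

theorem MDifferentiableAt.differentiableAt_comp_extChartAt_symm {h : M → F} {x : M}
    (hh : MDifferentiableAt (𝓡 m) 𝓘(ℝ, F) h x) :
    DifferentiableAt ℝ (h ∘ (extChartAt (𝓡 m) x).symm) (extChartAt (𝓡 m) x x) := by
  have := ((mdifferentiableAt_iff _ _).1 hh).2
  rw [(𝓡 m).range_eq_univ] at this
  exact differentiableWithinAt_univ.1 this

theorem fderiv_clm_apply₂ {E : Type*} [NormedAddCommGroup E] [NormedSpace ℝ E]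
    {G : E → F →L[ℝ] F →L[ℝ] ℝ} {a b : E → F} {x : E} (hG : DifferentiableAt ℝ G x)
    (ha : DifferentiableAt ℝ a x) (hb : DifferentiableAt ℝ b x) (u : E) :
    fderiv ℝ (fun y ↦ G y (a y) (b y)) x u =
      fderiv ℝ G x u (a x) (b x) + G x (fderiv ℝ a x u) (b x) + G x (a x) (fderiv ℝ b x u) := by
  rw [fderiv_clm_apply (hG.clm_apply ha) hb, fderiv_clm_apply hG ha]
  simp only [_root_.add_apply, ContinuousLinearMap.comp_apply, ContinuousLinearMap.flip_apply]
  ring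

/-- The product rule for a metric with coefficient matrix `G` and vectors with components `a`, `b`.
-/
theorem mvfderiv_clm_apply₂ {G : M → F →L[ℝ] F →L[ℝ] ℝ} {a b : M → F} {x : M}
    (hG : MDifferentiableAt (𝓡 m) 𝓘(ℝ, F →L[ℝ] F →L[ℝ] ℝ) G x)
    (ha : MDifferentiableAt (𝓡 m) 𝓘(ℝ, F) a x) (hb : MDifferentiableAt (𝓡 m) 𝓘(ℝ, F) b x)
    (u : TangentSpace (𝓡 m) x) :
    mvfderiv (𝓡 m) (fun y ↦ G y (a y) (b y)) x u =
      mvfderiv (𝓡 m) G x u (a x) (b x) + G x (mvfderiv (𝓡 m) a x u) (b x) +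
        G x (a x) (mvfderiv (𝓡 m) b x u) := by
  have hs : (extChartAt (𝓡 m) x).symm (extChartAt (𝓡 m) x x) = x := extChartAt_to_inv x
  have hG' := hG.differentiableAt_comp_extChartAt_symm
  have ha' := ha.differentiableAt_comp_extChartAt_symm
  have hb' := hb.differentiableAt_comp_extChartAt_symm
  rw [((hG.clm_apply ha).clm_apply hb).mvfderiv_eq_fderiv, hG.mvfderiv_eq_fderiv,
    ha.mvfderiv_eq_fderiv, hb.mvfderiv_eq_fderiv]
  have := fderiv_clm_apply₂ hG' ha' hb' u
  simp only [Function.comp_apply, hs] at this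
  exact this

variable [IsManifold (𝓡 k) ∞ N]

/-- The metric in the trivialization of the tangent bundle at `x₀`. -/
noncomputable def SemiRiemannianMetric.coord (g : SemiRiemannianMetric k N) (x₀ z : N) :
    EuclideanSpace ℝ (Fin k) →L[ℝ] EuclideanSpace ℝ (Fin k) →L[ℝ] ℝ :=
  inCoordinates (EuclideanSpace ℝ (Fin k)) (TangentSpace (𝓡 k) : N → Type _)
    (EuclideanSpace ℝ (Fin k) →L[ℝ] ℝ)
    (fun x : N ↦ TangentSpace (𝓡 k) x →L[ℝ] Trivial N ℝ x) x₀ z x₀ z (g.inner z)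

theorem SemiRiemannianMetric.contMDiffAt_coord (g : SemiRiemannianMetric k N) (x₀ : N) :
    ContMDiffAt (𝓡 k) 𝓘(ℝ, EuclideanSpace ℝ (Fin k) →L[ℝ] EuclideanSpace ℝ (Fin k) →L[ℝ] ℝ) ∞
      (g.coord x₀) x₀ :=
  ((contMDiffAt_hom_bundle _).1 g.contMDiff.contMDiffAt).2

theorem SemiRiemannianMetric.coord_trivialization (g : SemiRiemannianMetric k N) {x₀ z : N}
    (hz : z ∈ (trivializationAt (EuclideanSpace ℝ (Fin k))
      (TangentSpace (𝓡 k) : N → Type _) x₀).baseSet) (v w : TangentSpace (𝓡 k) z) :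
    let e := trivializationAt (EuclideanSpace ℝ (Fin k)) (TangentSpace (𝓡 k) : N → Type _) x₀
    g.coord x₀ z (e ⟨z, v⟩).2 (e ⟨z, w⟩).2 = g.inner z v w := by
  intro e
  rw [coord, inCoordinates_apply_eq₂ hz hz (Set.mem_univ _)]
  have h (v : TangentSpace (𝓡 k) z) : e.symm z (e ⟨z, v⟩).2 = v :=
    e.symm_apply_apply_mk hz v
  have h1 := h v
  have h2 := h w
  simp only [e] at h1 h2 ⊢
  rw [h1, h2]
  simp

/-- `FiberBundle.extend` is the frame field with constant components, the one used in
`CovariantDerivative.along`. -/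
theorem trivializationAt_extend_snd {x₀ z : N}
    (hz : z ∈ (trivializationAt (EuclideanSpace ℝ (Fin k))
      (TangentSpace (𝓡 k) : N → Type _) x₀).baseSet) (v : TangentSpace (𝓡 k) x₀) :
    let e := trivializationAt (EuclideanSpace ℝ (Fin k)) (TangentSpace (𝓡 k) : N → Type _) x₀
    (e ⟨z, FiberBundle.extend (EuclideanSpace ℝ (Fin k)) v z⟩).2 = (e ⟨x₀, v⟩).2 := by
  intro e
  rw [FiberBundle.extend, e.apply_mk_symm hz]

/-- The pullback of a metric connection is metric. -/
theorem IsLeviCivita.mvfderiv_inner_along {g : SemiRiemannianMetric k N}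
    {cov : CovariantDerivative (𝓡 k) (EuclideanSpace ℝ (Fin k))
      (TangentSpace (𝓡 k) : N → Type _)} (hcov : IsLeviCivita g cov) {φ : M → N} {x : M}
    {X Y : Π x : M, TangentSpace (𝓡 k) (φ x)}
    (hX : MDifferentiableAt (𝓡 m) (𝓡 k).tangent (fun y ↦ (⟨φ y, X y⟩ : TangentBundle (𝓡 k) N)) x)
    (hY : MDifferentiableAt (𝓡 m) (𝓡 k).tangent (fun y ↦ (⟨φ y, Y y⟩ : TangentBundle (𝓡 k) N)) x)
    (u : TangentSpace (𝓡 m) x) :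
    mvfderiv (𝓡 m) (fun y ↦ g.inner (φ y) (X y) (Y y)) x u =
      g.inner (φ x) (cov.along φ X x u) (Y x) + g.inner (φ x) (X x) (cov.along φ Y x u) := by
  set e := trivializationAt (EuclideanSpace ℝ (Fin k)) (TangentSpace (𝓡 k) : N → Type _) (φ x)
    with he
  obtain ⟨hφ, ha⟩ := (mdifferentiableAt_totalSpace _ _).1 hX
  obtain ⟨-, hb⟩ := (mdifferentiableAt_totalSpace _ _).1 hY
  simp only at hφ ha hb
  have hx : φ x ∈ e.baseSet := FiberBundle.mem_baseSet_trivializationAt' _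
  have hG := (g.contMDiffAt_coord (φ x)).mdifferentiableAt (by simp)
  have hGφ : MDifferentiableAt (𝓡 m)
      𝓘(ℝ, EuclideanSpace ℝ (Fin k) →L[ℝ] EuclideanSpace ℝ (Fin k) →L[ℝ] ℝ)
      (fun y ↦ g.coord (φ x) (φ y)) x := hG.comp x hφ
  have hbase : ∀ᶠ z in 𝓝 (φ x), z ∈ e.baseSet := e.open_baseSet.mem_nhds hx
  have h1 : (fun y ↦ g.inner (φ y) (X y) (Y y)) =ᶠ[𝓝 x]
      fun y ↦ g.coord (φ x) (φ y) (e ⟨φ y, X y⟩).2 (e ⟨φ y, Y y⟩).2 := by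
    filter_upwards [hφ.continuousAt.eventually hbase] with y hy
    exact (g.coord_trivialization hy _ _).symm
  have h2 : (fun z ↦ g.inner z (FiberBundle.extend (EuclideanSpace ℝ (Fin k)) (X x) z)
        (FiberBundle.extend (EuclideanSpace ℝ (Fin k)) (Y x) z)) =ᶠ[𝓝 (φ x)]
      fun z ↦ g.coord (φ x) z (e ⟨φ x, X x⟩).2 (e ⟨φ x, Y x⟩).2 := by
    filter_upwards [hbase] with z hz
    have := g.coord_trivialization hz (FiberBundle.extend (EuclideanSpace ℝ (Fin k)) (X x) z)
      (FiberBundle.extend (EuclideanSpace ℝ (Fin k)) (Y x) z)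
    simp only at this
    rw [← this, trivializationAt_extend_snd hz, trivializationAt_extend_snd hz]
  -- On fields with constant components, metric compatibility computes the derivative of the
  -- coefficients of `g` alone. The product rule along `φ` adds the derivatives of the components,
  -- which are the other summand of `along`.
  have h3 := hcov.metric (x := φ x)
    (FiberBundle.mdifferentiableAt_extend (𝓡 k) (EuclideanSpace ℝ (Fin k)) (X x))
    (FiberBundle.mdifferentiableAt_extend (𝓡 k) (EuclideanSpace ℝ (Fin k)) (Y x))
    (mfderiv (𝓡 m) (𝓡 k) φ x u)
  rw [h2.mvfderiv_apply_eq, mvfderiv_clm_apply₂ hG mdifferentiableAt_const mdifferentiableAt_const]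
    at h3
  rw [h1.mvfderiv_apply_eq, mvfderiv_clm_apply₂ hGφ ha hb, mvfderiv_comp_mfderiv hG hφ]
  have hsymm (v : EuclideanSpace ℝ (Fin k)) : (e ⟨φ x, e.symmL ℝ (φ x) v⟩).2 = v := by
    have := e.continuousLinearMapAt_symmL (R := ℝ) hx v
    rwa [e.continuousLinearMapAt_apply ℝ, e.coe_linearMapAt_of_mem hx] at this
  have hgc (v : EuclideanSpace ℝ (Fin k)) (w : TangentSpace (𝓡 k) (φ x)) :
      g.coord (φ x) (φ x) v (e ⟨φ x, w⟩).2 = g.inner (φ x) (e.symmL ℝ (φ x) v) w := by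
    have := g.coord_trivialization hx (e.symmL ℝ (φ x) v) w
    simp only at this
    rw [← this, hsymm]
  have hgc' (v : EuclideanSpace ℝ (Fin k)) (w : TangentSpace (𝓡 k) (φ x)) :
      g.coord (φ x) (φ x) (e ⟨φ x, w⟩).2 v = g.inner (φ x) w (e.symmL ℝ (φ x) v) := by
    have := g.coord_trivialization hx w (e.symmL ℝ (φ x) v)
    simp only at this
    rw [← this, hsymm]
  simp only [mvfderiv_const, FiberBundle.extend_apply_self, _root_.zero_apply,
    map_zero, add_zero] at h3
  rw [h3, hgc, hgc', CovariantDerivative.along, CovariantDerivative.along]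
  simp only [_root_.add_apply, ContinuousLinearMap.comp_apply, map_add, ← he]
  ring

end Pullback

/-! ### Torsion of the pulled-back connection, and smoothness of fields through an immersion. -/

section Immersion

open ContinuousLinearMap VectorField

variable {k : ℕ} {N : Type*} [TopologicalSpace N] [ChartedSpace (EuclideanSpace ℝ (Fin k)) N]
  [IsManifold (𝓡 k) ∞ N]
  {m : ℕ} {M : Type*} [TopologicalSpace M] [ChartedSpace (EuclideanSpace ℝ (Fin m)) M]

/-- Components in the trivialization are the derivative of the chart, so fields with constant
components are constant combinations of coordinate fields. -/
theorem trivializationAt_snd_eq_mvfderiv {x₀ z : N}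
    (hz : z ∈ (trivializationAt (EuclideanSpace ℝ (Fin k))
      (TangentSpace (𝓡 k) : N → Type _) x₀).baseSet) (v : TangentSpace (𝓡 k) z) :
    (trivializationAt (EuclideanSpace ℝ (Fin k)) (TangentSpace (𝓡 k) : N → Type _) x₀ ⟨z, v⟩).2 =
      mvfderiv (𝓡 k) (extChartAt (𝓡 k) x₀) z v := by
  have h := congrArg (fun A ↦ A v)
    (TangentBundle.continuousLinearMapAt_trivializationAt (I := 𝓡 k) (x₀ := x₀) (x := z) hz)
  simp only [Trivialization.continuousLinearMapAt_apply,
    Trivialization.coe_linearMapAt_of_mem _ hz] at h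
  exact h

/-- Fields with constant coefficients in a chart commute: the chart sends both to constants, and its
differential is injective. -/
theorem mlieBracket_extend {z : N} (v w : TangentSpace (𝓡 k) z) :
    mlieBracket (𝓡 k) (FiberBundle.extend (EuclideanSpace ℝ (Fin k)) v)
      (FiberBundle.extend (EuclideanSpace ℝ (Fin k)) w) z = 0 := by
  have hb : ∀ᶠ y in 𝓝 z, y ∈ (trivializationAt (EuclideanSpace ℝ (Fin k))
      (TangentSpace (𝓡 k) : N → Type _) z).baseSet :=
    (trivializationAt (EuclideanSpace ℝ (Fin k))
      (TangentSpace (𝓡 k) : N → Type _) z).open_baseSet.mem_nhds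
      (FiberBundle.mem_baseSet_trivializationAt' z)
  have key (v : TangentSpace (𝓡 k) z) : (fun y ↦ mvfderiv (𝓡 k) (extChartAt (𝓡 k) z) y
      (FiberBundle.extend (EuclideanSpace ℝ (Fin k)) v y)) =ᶠ[𝓝 z]
      fun _ ↦ (trivializationAt (EuclideanSpace ℝ (Fin k))
        (TangentSpace (𝓡 k) : N → Type _) z ⟨z, v⟩).2 := by
    filter_upwards [hb] with y hy
    rw [← trivializationAt_snd_eq_mvfderiv hy, trivializationAt_extend_snd hy]
  have h := mvfderiv_mlieBracket (f := extChartAt (𝓡 k) z) (x := z) contMDiffAt_extChartAt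
    (FiberBundle.mdifferentiableAt_extend (𝓡 k) (EuclideanSpace ℝ (Fin k)) v)
    (FiberBundle.mdifferentiableAt_extend (𝓡 k) (EuclideanSpace ℝ (Fin k)) w)
    (mdifferentiableAt_const.congr_of_eventuallyEq (key v))
    (mdifferentiableAt_const.congr_of_eventuallyEq (key w))
  rw [(key v).mvfderiv_apply_eq, (key w).mvfderiv_apply_eq, mvfderiv_const, mvfderiv_const,
    _root_.zero_apply, _root_.zero_apply, sub_zero] at h
  have h' : mfderiv (𝓡 k) 𝓘(ℝ, EuclideanSpace ℝ (Fin k)) (extChartAt (𝓡 k) z) z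
    (mlieBracket (𝓡 k) (FiberBundle.extend (EuclideanSpace ℝ (Fin k)) v)
      (FiberBundle.extend (EuclideanSpace ℝ (Fin k)) w) z) = 0 := h
  rw [mfderiv_extChartAt_self] at h'
  exact h'

/-- The added term is tensorial, so it depends only on the value of the field at the point and pulls
back without a derivative. -/
theorem CovariantDerivative.along_addOneForm
    (cov : CovariantDerivative (𝓡 k) (EuclideanSpace ℝ (Fin k))
      (TangentSpace (𝓡 k) : N → Type _))
    (A : Π x : N, TangentSpace (𝓡 k) x →L[ℝ] TangentSpace (𝓡 k) x →L[ℝ] TangentSpace (𝓡 k) x)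
    (φ : M → N) (X : Π x : M, TangentSpace (𝓡 k) (φ x)) (x : M) (u : TangentSpace (𝓡 m) x) :
    (cov.addOneForm A).along φ X x u =
      cov.along φ X x u + A (φ x) (X x) (mfderiv (𝓡 m) (𝓡 k) φ x u) := by
  simp only [CovariantDerivative.along, CovariantDerivative.addOneForm, _root_.add_apply,
    ContinuousLinearMap.comp_apply]
  change _ + (cov _ (φ x) _ + A (φ x) (FiberBundle.extend (EuclideanSpace ℝ (Fin k)) (X x) (φ x)) _)
    = _
  rw [FiberBundle.extend_apply_self, add_assoc]

variable [IsManifold (𝓡 m) ∞ M]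

theorem mdifferentiableAt_mfderiv_apply {φ : M → N} (hφ : ContMDiff (𝓡 m) (𝓡 k) ∞ φ)
    {V : Π x : M, TangentSpace (𝓡 m) x} {x : M}
    (hV : MDifferentiableAt (𝓡 m) (𝓡 m).tangent (fun y ↦ (⟨y, V y⟩ : TangentBundle (𝓡 m) M)) x) :
    MDifferentiableAt (𝓡 m) (𝓡 k).tangent
      (fun y ↦ (⟨φ y, mfderiv (𝓡 m) (𝓡 k) φ y (V y)⟩ : TangentBundle (𝓡 k) N)) x :=
  ((hφ.contMDiff_tangentMap (m := 1) (by norm_cast)).mdifferentiable (by simp) _).comp x hV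

/-- The pullback of a torsion-free connection is torsion-free. -/
theorem CovariantDerivative.along_mfderiv_sub
    {cov : CovariantDerivative (𝓡 k) (EuclideanSpace ℝ (Fin k))
      (TangentSpace (𝓡 k) : N → Type _)} (hcov : cov.torsion = 0) {φ : M → N}
    (hφ : ContMDiff (𝓡 m) (𝓡 k) ∞ φ) {U V : Π x : M, TangentSpace (𝓡 m) x} {x : M}
    (hU : MDifferentiableAt (𝓡 m) (𝓡 m).tangent (fun y ↦ (⟨y, U y⟩ : TangentBundle (𝓡 m) M)) x)
    (hV : MDifferentiableAt (𝓡 m) (𝓡 m).tangent (fun y ↦ (⟨y, V y⟩ : TangentBundle (𝓡 m) M)) x) :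
    cov.along φ (fun y ↦ mfderiv (𝓡 m) (𝓡 k) φ y (V y)) x (U x) -
        cov.along φ (fun y ↦ mfderiv (𝓡 m) (𝓡 k) φ y (U y)) x (V x) =
      mfderiv (𝓡 m) (𝓡 k) φ x (mlieBracket (𝓡 m) U V x) := by
  set e := trivializationAt (EuclideanSpace ℝ (Fin k)) (TangentSpace (𝓡 k) : N → Type _) (φ x)
    with he
  have hx : φ x ∈ e.baseSet := FiberBundle.mem_baseSet_trivializationAt' _
  have hφ' (y : M) : MDifferentiableAt (𝓡 m) (𝓡 k) φ y := hφ.mdifferentiable (by simp) y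
  have hb : ∀ᶠ y in 𝓝 x, φ y ∈ e.baseSet :=
    hφ.continuous.continuousAt.eventually (e.open_baseSet.mem_nhds hx)
  have hf : ContMDiffAt (𝓡 m) 𝓘(ℝ, EuclideanSpace ℝ (Fin k)) 2
      (fun y ↦ extChartAt (𝓡 k) (φ x) (φ y)) x :=
    (contMDiffAt_extChartAt (x := φ x)).comp x ((hφ x).of_le (by norm_cast))
  have key (W : Π x : M, TangentSpace (𝓡 m) x) :
      (fun y ↦ (e ⟨φ y, mfderiv (𝓡 m) (𝓡 k) φ y (W y)⟩).2) =ᶠ[𝓝 x]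
        fun y ↦ mvfderiv (𝓡 m) (fun y ↦ extChartAt (𝓡 k) (φ x) (φ y)) y (W y) := by
    filter_upwards [hb] with y hy
    rw [mvfderiv_comp_mfderiv (mdifferentiableAt_extChartAt hy) (hφ' y),
      ← trivializationAt_snd_eq_mvfderiv hy]
  have hd {W : Π x : M, TangentSpace (𝓡 m) x} (hW : MDifferentiableAt (𝓡 m) (𝓡 m).tangent
      (fun y ↦ (⟨y, W y⟩ : TangentBundle (𝓡 m) M)) x) :=
    ((mdifferentiableAt_totalSpace _ _).1
      (mdifferentiableAt_mfderiv_apply hφ hW)).2.congr_of_eventuallyEq (key W).symm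
  have h1 := mvfderiv_mlieBracket hf hU hV (hd hU) (hd hV)
  rw [mvfderiv_comp_mfderiv (mdifferentiableAt_extChartAt (mem_chart_source _ _)) (hφ' x),
    ← trivializationAt_snd_eq_mvfderiv hx] at h1
  -- Zero torsion on commuting frame fields is the symmetry of the Christoffel symbols. The frame
  -- terms therefore cancel in the difference, leaving the derivatives of components given by `h1`.
  have h2 := cov.torsion_apply_eq_extend (mfderiv (𝓡 m) (𝓡 k) φ x (U x))
    (mfderiv (𝓡 m) (𝓡 k) φ x (V x))
  rw [mlieBracket_extend, hcov, FiberBundle.extend_apply_self, FiberBundle.extend_apply_self,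
    sub_zero] at h2
  have h3 := e.symmL_continuousLinearMapAt (R := ℝ) hx
    (mfderiv (𝓡 m) (𝓡 k) φ x (mlieBracket (𝓡 m) U V x))
  rw [e.continuousLinearMapAt_apply ℝ, e.coe_linearMapAt_of_mem hx] at h3
  rw [← h3]
  beta_reduce
  rw [h1, CovariantDerivative.along, CovariantDerivative.along]
  simp only [_root_.add_apply, ContinuousLinearMap.comp_apply, map_sub, ← he]
  rw [(key U).mvfderiv_apply_eq, (key V).mvfderiv_apply_eq]
  have h4 := sub_eq_zero.1 h2.symm
  rw [h4]
  abel

/-- A vector field is smooth if its image under an immersion is. -/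
theorem contMDiffAt_of_mfderiv_apply {φ : M → N} {x : M} (hφ : ContMDiffAt (𝓡 m) (𝓡 k) ∞ φ x)
    (hinj : Function.Injective (mfderiv (𝓡 m) (𝓡 k) φ x)) {X : Π x : M, TangentSpace (𝓡 m) x}
    (hX : ContMDiffAt (𝓡 m) (𝓡 k).tangent ∞
      (fun y ↦ (⟨φ y, mfderiv (𝓡 m) (𝓡 k) φ y (X y)⟩ : TangentBundle (𝓡 k) N)) x) :
    ContMDiffAt (𝓡 m) (𝓡 m).tangent ∞ (fun y ↦ (⟨y, X y⟩ : TangentBundle (𝓡 m) M)) x := by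
  set e := trivializationAt (EuclideanSpace ℝ (Fin m)) (TangentSpace (𝓡 m) : M → Type _) x with he
  set e' := trivializationAt (EuclideanSpace ℝ (Fin k)) (TangentSpace (𝓡 k) : N → Type _) (φ x)
    with he'
  have hx : x ∈ e.baseSet := FiberBundle.mem_baseSet_trivializationAt' _
  have hx' : φ x ∈ e'.baseSet := FiberBundle.mem_baseSet_trivializationAt' _
  let A (y : M) : EuclideanSpace ℝ (Fin m) →L[ℝ] EuclideanSpace ℝ (Fin k) :=
    e'.continuousLinearMapAt ℝ (φ y) ∘L mfderiv (𝓡 m) (𝓡 k) φ y ∘L e.symmL ℝ y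
  have hA : ContMDiffAt (𝓡 m)
      𝓘(ℝ, EuclideanSpace ℝ (Fin m) →L[ℝ] EuclideanSpace ℝ (Fin k)) ∞ A x :=
    hφ.mfderiv_const (m := ∞) (by simp)
  have hAinj : Function.Injective (A x) := by
    have hAx : A x = _ := inCoordinates_eq hx hx'
    rw [hAx]
    exact (e'.continuousLinearEquivAt ℝ (φ x) hx').injective.comp
      (hinj.comp (e.continuousLinearEquivAt ℝ x hx).symm.injective)
  -- A left inverse chosen at the single point `x` suffices: `B ∘ A y` is the identity at `x`, hence
  -- invertible near `x` with smooth inverse, and this recovers the components of `X` from those of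
  -- its image.
  obtain ⟨B, hB⟩ := (A x).toLinearMap.exists_leftInverse_of_injective
    (LinearMap.ker_eq_bot.2 hAinj)
  let C (y : M) : EuclideanSpace ℝ (Fin m) →L[ℝ] EuclideanSpace ℝ (Fin m) :=
    B.toContinuousLinearMap ∘L A y
  have hCx : C x = (ContinuousLinearEquiv.refl ℝ (EuclideanSpace ℝ (Fin m)) :
      EuclideanSpace ℝ (Fin m) →L[ℝ] EuclideanSpace ℝ (Fin m)) := by
    ext1 v
    exact LinearMap.congr_fun hB v
  have hC : ContMDiffAt (𝓡 m)
      𝓘(ℝ, EuclideanSpace ℝ (Fin m) →L[ℝ] EuclideanSpace ℝ (Fin m)) ∞ C x :=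
    contMDiffAt_const.clm_comp hA
  have hinv : ContMDiffAt (𝓡 m)
      𝓘(ℝ, EuclideanSpace ℝ (Fin m) →L[ℝ] EuclideanSpace ℝ (Fin m)) ∞
      (fun y ↦ (C y).inverse) x := by
    have := contDiffAt_map_inverse (𝕜 := ℝ) (n := ∞)
      (ContinuousLinearEquiv.refl ℝ (EuclideanSpace ℝ (Fin m)))
    rw [← hCx] at this
    exact this.contMDiffAt.comp x hC
  have hb := ((contMDiffAt_totalSpace).1 hX).2
  simp only [← he'] at hb
  rw [contMDiffAt_section (IB := 𝓡 m)]
  refine (hinv.clm_apply ((contMDiffAt_const (c := B.toContinuousLinearMap)).clm_apply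
    hb)).congr_of_eventuallyEq ?_
  have hCu : ∀ᶠ y in 𝓝 x, C y ∈ Set.range ((↑) : (EuclideanSpace ℝ (Fin m) ≃L[ℝ]
      EuclideanSpace ℝ (Fin m)) → EuclideanSpace ℝ (Fin m) →L[ℝ] EuclideanSpace ℝ (Fin m)) :=
    hC.continuousAt.eventually (by rw [hCx]; exact ContinuousLinearEquiv.nhds _)
  filter_upwards [hCu, e.open_baseSet.mem_nhds hx,
    hφ.continuousAt.eventually (e'.open_baseSet.mem_nhds hx')] with y ⟨c, hc⟩ hy hy'
  have h1 : A y (e ⟨y, X y⟩).2 = (e' ⟨φ y, mfderiv (𝓡 m) (𝓡 k) φ y (X y)⟩).2 := by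
    have h2 : e.symmL ℝ y (e ⟨y, X y⟩).2 = X y := by
      rw [e.symmL_apply (R := ℝ) hy]
      exact e.symm_apply_apply_mk hy (X y)
    simp only [A, ContinuousLinearMap.comp_apply, h2]
    rw [e'.continuousLinearMapAt_apply ℝ, e'.coe_linearMapAt_of_mem hy']
  have h3 : C y (e ⟨y, X y⟩).2 =
      B.toContinuousLinearMap (e' ⟨φ y, mfderiv (𝓡 m) (𝓡 k) φ y (X y)⟩).2 := by
    rw [← h1]
    rfl
  rw [← h3, ← hc, ContinuousLinearMap.inverse_equiv]
  exact (c.symm_apply_apply _).symm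

end Immersion

/-! ### Orthogonality relations on a lightlike submanifold. -/

namespace LightlikeSubmanifold

open VectorField

variable {m k r : ℕ}
  {M : Type*} [TopologicalSpace M] [ChartedSpace (EuclideanSpace ℝ (Fin m)) M]
  {N : Type*} [TopologicalSpace N] [ChartedSpace (EuclideanSpace ℝ (Fin k)) N]
  [IsManifold (𝓡 k) ∞ N] [IsManifold (𝓡 m) ∞ M]
  {g : SemiRiemannianMetric k N} (L : LightlikeSubmanifold m M g r)

theorem mem_rad {x : M} {v : TangentSpace (𝓡 m) x} :
    v ∈ L.rad x ↔ ∀ w, g.inner (L.φ x) (L.dφ x w) (L.dφ x v) = 0 := by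
  refine ⟨fun h w ↦ h _ ⟨w, rfl⟩, fun h ↦ ?_⟩
  rintro _ ⟨w, rfl⟩
  exact h w

theorem tangentialPart_dφ (x : M) (v : TangentSpace (𝓡 m) x) :
    L.tangentialPart x (L.dφ x v) = v := by
  have h : (tangentImage m L.φ x).projectionOnto (L.tr x) (L.isCompl_tr x) (L.dφ x v) =
      ⟨L.dφ x v, ⟨v, rfl⟩⟩ :=
    Submodule.projectionOnto_apply_left (L.isCompl_tr x) ⟨L.dφ x v, ⟨v, rfl⟩⟩
  exact (congrArg (LinearEquiv.ofInjective (mfderiv (𝓡 m) (𝓡 k) L.φ x).toLinearMap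
    (L.injective_mfderiv x)).symm h).trans (LinearEquiv.symm_apply_apply _ v)

theorem sub_dφ_tangentialPart_mem (x : M) (w : TangentSpace (𝓡 k) (L.φ x)) :
    w - L.dφ x (L.tangentialPart x w) ∈ L.tr x := by
  have h : L.dφ x (L.tangentialPart x w) =
      (tangentImage m L.φ x).projectionOnto (L.tr x) (L.isCompl_tr x) w :=
    congrArg Subtype.val (LinearEquiv.apply_symm_apply
      (LinearEquiv.ofInjective (mfderiv (𝓡 m) (𝓡 k) L.φ x).toLinearMap (L.injective_mfderiv x)) _)
  rw [h, ← Submodule.projectionOnto_apply_eq_zero_iff (L.isCompl_tr x), map_sub, sub_eq_zero]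
  exact (Submodule.projectionOnto_apply_left (L.isCompl_tr x) _).symm

/-- Hence taking the tangential part in the Gauss formula does not change inner products with S(TM).
-/
theorem inner_tr_screen {x : M} {w : TangentSpace (𝓡 k) (L.φ x)} (hw : w ∈ L.tr x)
    {z : TangentSpace (𝓡 m) x} (hz : z ∈ L.screen x) :
    g.inner (L.φ x) w (L.dφ x z) = 0 := by
  obtain ⟨l, hl, s, hs, rfl⟩ := Submodule.mem_sup.1 hw
  have h1 := (L.ltr_sup x).le (Submodule.mem_sup_left hl)
  have h2 := (L.screenTransversal_sup x).le (Submodule.mem_sup_left hs)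
  have h1' : g.inner (L.φ x) (L.dφ x z) l = 0 := h1.1 _ ⟨z, hz, rfl⟩
  have h2' : g.inner (L.φ x) (L.dφ x z) s = 0 := h2 _ ⟨z, rfl⟩
  rw [g.symm, map_add, h1', h2', add_zero]

/-- The induced metric is nondegenerate on the screen distribution. -/
theorem eq_of_inner_screen {x : M} {v w : TangentSpace (𝓡 m) x} (hv : v ∈ L.screen x)
    (hw : w ∈ L.screen x) (h : ∀ z ∈ L.screen x, g.inner (L.φ x) (L.dφ x v) (L.dφ x z) =
      g.inner (L.φ x) (L.dφ x w) (L.dφ x z)) : v = w := by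
  have hs : v - w ∈ L.screen x := sub_mem hv hw
  have hr : v - w ∈ L.rad x := by
    rw [L.mem_rad]
    intro y
    have hy : y ∈ L.screen x ⊔ L.rad x := (L.isCompl_screen x).sup_eq_top ▸ Submodule.mem_top
    obtain ⟨s, hs', t, ht, rfl⟩ := Submodule.mem_sup.1 hy
    rw [g.symm, map_add, map_add, (L.mem_rad.1 ht), map_sub, map_sub, sub_apply, h s hs',
      sub_self, add_zero]
  exact sub_eq_zero.1 (Submodule.disjoint_def.1 (L.isCompl_screen x).disjoint _ hs hr)

/-- The discarded component lies in Rad(TM), which is orthogonal to all of TM. -/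
theorem inner_projection_screen (x : M) (v z : TangentSpace (𝓡 m) x) :
    g.inner (L.φ x) (L.dφ x ((L.screen x).projection (L.rad x) (L.isCompl_screen x) v))
      (L.dφ x z) = g.inner (L.φ x) (L.dφ x v) (L.dφ x z) := by
  have h : v - (L.screen x).projection (L.rad x) (L.isCompl_screen x) v ∈ L.rad x := by
    rw [← Submodule.projection_apply_eq_zero_iff (L.isCompl_screen x), map_sub, sub_eq_zero]
    exact (Submodule.projection_apply_left (L.isCompl_screen x)
      ⟨_, Submodule.projection_apply_mem (L.isCompl_screen x) v⟩).symm
  have := L.mem_rad.1 h z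
  rw [g.symm, map_sub, map_sub, sub_apply, sub_eq_zero] at this
  exact this.symm

/-! ### The Koszul formula on the radical. -/

section Koszul

variable {L} {cov : CovariantDerivative (𝓡 k) (EuclideanSpace ℝ (Fin k))
  (TangentSpace (𝓡 k) : N → Type _)}

theorem IsRadSection.mdifferentiableAt {U : Π x : M, TangentSpace (𝓡 m) x}
    (hU : L.IsRadSection U) (x : M) : MDifferentiableAt (𝓡 m) (𝓡 m).tangent
      (fun y ↦ (⟨y, U y⟩ : TangentBundle (𝓡 m) M)) x :=
  hU.1.mdifferentiable (by simp) x

theorem inner_along_add_inner_along (hcov : IsLeviCivita g cov)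
    {V W : Π x : M, TangentSpace (𝓡 m) x} {x : M}
    (hV : MDifferentiableAt (𝓡 m) (𝓡 m).tangent (fun y ↦ (⟨y, V y⟩ : TangentBundle (𝓡 m) M)) x)
    (hW : MDifferentiableAt (𝓡 m) (𝓡 m).tangent (fun y ↦ (⟨y, W y⟩ : TangentBundle (𝓡 m) M)) x)
    (h : ∀ y, g.inner (L.φ y) (L.dφ y (V y)) (L.dφ y (W y)) = 0) (u : TangentSpace (𝓡 m) x) :
    g.inner (L.φ x) (cov.along L.φ (fun y ↦ L.dφ y (V y)) x u) (L.dφ x (W x)) +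
      g.inner (L.φ x) (cov.along L.φ (fun y ↦ L.dφ y (W y)) x u) (L.dφ x (V x)) = 0 := by
  have := hcov.mvfderiv_inner_along (mdifferentiableAt_mfderiv_apply L.contMDiff hV)
    (mdifferentiableAt_mfderiv_apply L.contMDiff hW) u
  have h0 : (fun y ↦ g.inner (L.φ y) (mfderiv (𝓡 m) (𝓡 k) L.φ y (V y))
      (mfderiv (𝓡 m) (𝓡 k) L.φ y (W y))) = fun _ ↦ 0 := funext h
  rw [h0, mvfderiv_const] at this
  rw [g.symm _ (cov.along L.φ (fun y ↦ L.dφ y (W y)) x u)]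
  exact this.symm

/-- The Koszul formula for sections of the radical. -/
theorem two_mul_inner_along (hcov : IsLeviCivita g cov) {U V : Π x : M, TangentSpace (𝓡 m) x}
    (hU : L.IsRadSection U) (hV : L.IsRadSection V) (x : M) (z : TangentSpace (𝓡 m) x) :
    2 * g.inner (L.φ x) (cov.along L.φ (fun y ↦ L.dφ y (V y)) x (U x)) (L.dφ x z) =
      g.inner (L.φ x) (L.dφ x (mlieBracket (𝓡 m) U V x)) (L.dφ x z) := by
  -- Any extension of `z` differentiable at `x` would do: both sides of the formula depend only on
  -- its value there.
  let Z := FiberBundle.extend (EuclideanSpace ℝ (Fin m)) z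
  have hZx : Z x = z := FiberBundle.extend_apply_self _ z
  have hZ := FiberBundle.mdifferentiableAt_extend (𝓡 m) (EuclideanSpace ℝ (Fin m)) z
  have hUx := hU.mdifferentiableAt x
  have hVx := hV.mdifferentiableAt x
  have orth {W : Π x : M, TangentSpace (𝓡 m) x} (hW : L.IsRadSection W)
      (Y : Π x : M, TangentSpace (𝓡 m) x) (y : M) :
      g.inner (L.φ y) (L.dφ y (Y y)) (L.dφ y (W y)) = 0 := L.mem_rad.1 (hW.2 y) _
  have tors {X Y : Π x : M, TangentSpace (𝓡 m) x}
      (hX : MDifferentiableAt (𝓡 m) (𝓡 m).tangent (fun y ↦ (⟨y, X y⟩ : TangentBundle (𝓡 m) M)) x)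
      (hY : MDifferentiableAt (𝓡 m) (𝓡 m).tangent (fun y ↦ (⟨y, Y y⟩ : TangentBundle (𝓡 m) M)) x)
      (w : TangentSpace (𝓡 m) x) :
      g.inner (L.φ x) (cov.along L.φ (fun y ↦ L.dφ y (Y y)) x (X x)) (L.dφ x w) -
        g.inner (L.φ x) (cov.along L.φ (fun y ↦ L.dφ y (X y)) x (Y x)) (L.dφ x w) =
      g.inner (L.φ x) (L.dφ x (mlieBracket (𝓡 m) X Y x)) (L.dφ x w) := by
    have := CovariantDerivative.along_mfderiv_sub hcov.torsion_eq_zero L.contMDiff hX hY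
    rw [← sub_apply, ← map_sub]
    exact congrArg (fun a ↦ g.inner (L.φ x) a (L.dφ x w)) this
  have e1 := inner_along_add_inner_along hcov hZ hVx (orth hV Z) (U x)
  have e2 := inner_along_add_inner_along hcov hZ hUx (orth hU Z) (V x)
  have e3 := inner_along_add_inner_along hcov hVx hUx (orth hU V) (Z x)
  have t1 := tors hUx hVx z
  have t2 := tors hUx hZ (V x)
  have t3 := tors hVx hZ (U x)
  -- The brackets with `Z` are tangent to M, hence orthogonal to the radical vectors `V x` and `U
  -- x`.
  rw [orth hV (mlieBracket (𝓡 m) U Z)] at t2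
  rw [orth hU (mlieBracket (𝓡 m) V Z)] at t3
  change _ + g.inner (L.φ x) _ (L.dφ x (Z x)) = 0 at e1
  simp only [Z, hZx] at e1 e2 e3 t1 t2 t3
  linarith

end Koszul

variable {p q : ℕ} {J : MetallicStructure g p q}

/-! ### The action of J on radical sections, and the shape operator. -/

section Invariant

variable {L}

theorem IsInvariant.exists_dφ_eq (hL : L.IsInvariant J) {x : M} {v : TangentSpace (𝓡 m) x}
    (hv : v ∈ L.rad x) : ∃ w ∈ L.rad x, L.dφ x w = J.toFun (L.φ x) (L.dφ x v) := by
  have : J.toFun (L.φ x) (L.dφ x v) ∈ (L.rad x).map (L.dφ x).toLinearMap := by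
    rw [← hL.1 x]
    exact ⟨_, ⟨v, hv, rfl⟩, rfl⟩
  exact this

theorem IsInvariant.dφ_tangentialJ (hL : L.IsInvariant J) {U : Π x : M, TangentSpace (𝓡 m) x}
    {x : M} (hU : U x ∈ L.rad x) :
    L.dφ x (L.tangentialJ J U x) = J.toFun (L.φ x) (L.dφ x (U x)) := by
  obtain ⟨w, -, hw⟩ := hL.exists_dφ_eq hU
  rw [tangentialJ, ← hw, tangentialPart_dφ]

/-- The criterion quantifies over smooth sections, and the converse applies it to J U and J V.
Smoothness passes through the ambient field J dφ(U), using that φ is an immersion. -/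
theorem IsInvariant.isRadSection_tangentialJ (hL : L.IsInvariant J)
    {U : Π x : M, TangentSpace (𝓡 m) x} (hU : L.IsRadSection U) :
    L.IsRadSection (L.tangentialJ J U) := by
  refine ⟨fun x ↦ ?_, fun x ↦ ?_⟩
  · refine contMDiffAt_of_mfderiv_apply L.contMDiff.contMDiffAt (L.injective_mfderiv x) ?_
    have h1 : ContMDiff (𝓡 m) (𝓡 k).tangent ∞
        (fun y ↦ (⟨L.φ y, L.dφ y (U y)⟩ : TangentBundle (𝓡 k) N)) :=
      (L.contMDiff.contMDiff_tangentMap (m := ∞) (by norm_cast)).comp hU.1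
    have h2 := (J.contMDiff.comp L.contMDiff).contMDiffAt (x := x)
    have h3 := ContMDiffAt.clm_bundle_apply (b := L.φ) (ϕ := fun y ↦ J.toFun (L.φ y)) h2
      h1.contMDiffAt
    refine h3.congr_of_eventuallyEq (Filter.Eventually.of_forall fun y ↦ ?_)
    have := hL.dφ_tangentialJ (hU.2 y)
    exact congrArg (TotalSpace.mk' (EuclideanSpace ℝ (Fin k)) (L.φ y)) this
  · obtain ⟨w, hw, hw'⟩ := hL.exists_dφ_eq (hU.2 x)
    rwa [tangentialJ, ← hw', tangentialPart_dφ]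

theorem IsInvariant.tangentialJ_tangentialJ (hL : L.IsInvariant J)
    {U : Π x : M, TangentSpace (𝓡 m) x} (hU : L.IsRadSection U) :
    L.tangentialJ J (L.tangentialJ J U) = (p : ℝ) • L.tangentialJ J U + (q : ℝ) • U := by
  funext x
  apply L.injective_mfderiv x
  change L.dφ x _ = L.dφ x ((p : ℝ) • L.tangentialJ J U x + (q : ℝ) • U x)
  rw [hL.dφ_tangentialJ ((hL.isRadSection_tangentialJ hU).2 x), hL.dφ_tangentialJ (hU.2 x), J.sq,
    map_add, map_smul, map_smul, hL.dφ_tangentialJ (hU.2 x)]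

/-- On the radical, the shape operator is half the screen component of the Lie bracket. -/
theorem IsInvariant.screenShape_eq {cov : CovariantDerivative (𝓡 k) (EuclideanSpace ℝ (Fin k))
      (TangentSpace (𝓡 k) : N → Type _)} (hL : L.IsInvariant J) (hcov : IsLeviCivita g cov)
    (η : Π x : N, TangentSpace (𝓡 k) x) {U V : Π x : M, TangentSpace (𝓡 m) x}
    (hU : L.IsRadSection U) (hV : L.IsRadSection V) (x : M) :
    L.screenShape (quarterSymmetricConnection J η cov) V x (U x) =
      -((1 / 2 : ℝ) • (L.screen x).projection (L.rad x) (L.isCompl_screen x)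
        (mlieBracket (𝓡 m) U V x)) := by
  rw [screenShape, neg_inj]
  refine L.eq_of_inner_screen (Submodule.projection_apply_mem _ _)
    (Submodule.smul_mem _ _ (Submodule.projection_apply_mem _ _)) fun z hz ↦ ?_
  rw [L.inner_projection_screen, map_smul, map_smul, _root_.smul_apply, L.inner_projection_screen,
    ← two_mul_inner_along hcov hU hV]
  have h1 := L.inner_tr_screen (L.sub_dφ_tangentialPart_mem x
    ((quarterSymmetricConnection J η cov).along L.φ (fun y ↦ L.dφ y (V y)) x (U x))) hz
  rw [map_sub, sub_apply, sub_eq_zero] at h1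
  rw [inducedConnection, ← h1, quarterSymmetricConnection,
    CovariantDerivative.along_addOneForm, map_add, _root_.add_apply]
  -- J U is radical by invariance, so the term π(V) J U is invisible to the screen and only the
  -- Levi-Civita part counts.
  obtain ⟨w, hw, hw'⟩ := hL.exists_dφ_eq (hU.2 x)
  have h2 : g.inner (L.φ x) (J.toFun (L.φ x) (L.dφ x (U x))) (L.dφ x z) = 0 := by
    rw [← hw', g.symm]
    exact L.mem_rad.1 hw z
  have h3 : g.inner (L.φ x) (((g.inner (L.φ x) (η (L.φ x))).smulRight (J.toFun (L.φ x))
      (L.dφ x (V x))) (mfderiv (𝓡 m) (𝓡 k) L.φ x (U x))) (L.dφ x z) = 0 := by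
    rw [ContinuousLinearMap.smulRight_apply, _root_.smul_apply, map_smul, _root_.smul_apply]
    erw [h2]
    exact smul_zero _
  rw [h3, add_zero, smul_eq_mul]
  ring

end Invariant

theorem projection_mlieBracket_eq_zero_iff (U V : Π x : M, TangentSpace (𝓡 m) x) (x : M) :
    (L.screen x).projection (L.rad x) (L.isCompl_screen x) (mlieBracket (𝓡 m) U V x) = 0 ↔
      mlieBracket (𝓡 m) U V x ∈ L.rad x :=
  Submodule.projection_apply_eq_zero_iff _

end LightlikeSubmanifold

/-! ### The integrability criterion. -/

open LightlikeSubmanifold VectorField in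
theorem mainTheorem1 {m n r p q : ℕ} (hp : 0 < p) (hq : 0 < q)
    {N : Type*} [TopologicalSpace N] [T2Space N] [SecondCountableTopology N]
    [ChartedSpace (EuclideanSpace ℝ (Fin (m + n))) N] [IsManifold (𝓡 (m + n)) ∞ N]
    {M : Type*} [TopologicalSpace M] [T2Space M] [SecondCountableTopology M]
    [ChartedSpace (EuclideanSpace ℝ (Fin m)) M] [IsManifold (𝓡 m) ∞ M]
    (g : SemiRiemannianMetric (m + n) N)
    (cov : CovariantDerivative (𝓡 (m + n)) (EuclideanSpace ℝ (Fin (m + n)))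
      (TangentSpace (𝓡 (m + n)) : N → Type _))
    (hcov : IsLeviCivita g cov)
    (J : MetallicStructure g p q)
    (η : Π x : N, TangentSpace (𝓡 (m + n)) x)
    (hη : ContMDiff (𝓡 (m + n)) (𝓡 (m + n)).tangent ∞
      (fun x ↦ (⟨x, η x⟩ : TangentBundle (𝓡 (m + n)) N)))
    (L : LightlikeSubmanifold m M g r) (hL : L.IsInvariant J) :
    L.IsRadIntegrable ↔
      ∀ U V : Π x : M, TangentSpace (𝓡 m) x, L.IsRadSection U → L.IsRadSection V → ∀ x : M,
        L.screenShape (quarterSymmetricConnection J η cov) (L.tangentialJ J U) x (V x) -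
            (p : ℝ) • L.screenShape (quarterSymmetricConnection J η cov) U x (V x) =
          L.screenShape (quarterSymmetricConnection J η cov) (L.tangentialJ J V) x (U x) -
            (p : ℝ) • L.screenShape (quarterSymmetricConnection J η cov) V x (U x) := by
  constructor
  · intro h U V hU hV x
    have hz {X Y : Π x : M, TangentSpace (𝓡 m) x} (hX : L.IsRadSection X)
        (hY : L.IsRadSection Y) :
        L.screenShape (quarterSymmetricConnection J η cov) Y x (X x) = 0 := by
      rw [hL.screenShape_eq hcov η hX hY,
        (L.projection_mlieBracket_eq_zero_iff X Y x).2 (h X Y hX hY x), smul_zero, neg_zero]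
    rw [hz hV (hL.isRadSection_tangentialJ hU), hz hV hU,
      hz hU (hL.isRadSection_tangentialJ hV), hz hU hV]
  · intro h U V hU hV x
    -- Only antisymmetry and additivity over constants are used below; tensoriality of `β` is not
    -- needed because J² has constant coefficients.
    let β (X Y : Π x : M, TangentSpace (𝓡 m) x) : TangentSpace (𝓡 m) x :=
      (L.screen x).projection (L.rad x) (L.isCompl_screen x) (mlieBracket (𝓡 m) X Y x)
    have hswap (X Y : Π x : M, TangentSpace (𝓡 m) x) : β X Y = -β Y X := by
      simp only [β]
      rw [mlieBracket_swap_apply, map_neg]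
    -- The hypothesis after replacing each shape operator by -½ `β` and swapping arguments; each of
    -- the two terms with factor p contributes one p to 2p.
    have key {X Y : Π x : M, TangentSpace (𝓡 m) x} (hX : L.IsRadSection X)
        (hY : L.IsRadSection Y) :
        β (L.tangentialJ J X) Y + β X (L.tangentialJ J Y) = (2 * p : ℝ) • β X Y := by
      have e := h X Y hX hY x
      rw [hL.screenShape_eq hcov η hY (hL.isRadSection_tangentialJ hX),
        hL.screenShape_eq hcov η hY hX, hL.screenShape_eq hcov η hX (hL.isRadSection_tangentialJ hY),
        hL.screenShape_eq hcov η hX hY] at e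
      change -((1 / 2 : ℝ) • β Y (L.tangentialJ J X)) - (p : ℝ) • -((1 / 2 : ℝ) • β Y X) =
        -((1 / 2 : ℝ) • β X (L.tangentialJ J Y)) - (p : ℝ) • -((1 / 2 : ℝ) • β X Y) at e
      rw [hswap Y (L.tangentialJ J X), hswap Y X] at e
      linear_combination (norm := module) (2 : ℝ) • e
    have hJU := hL.isRadSection_tangentialJ hU
    have hJV := hL.isRadSection_tangentialJ hV
    have hleft {X : Π x : M, TangentSpace (𝓡 m) x} (hX : L.IsRadSection X)
        (Y : Π x : M, TangentSpace (𝓡 m) x) : β (L.tangentialJ J (L.tangentialJ J X)) Y =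
          (p : ℝ) • β (L.tangentialJ J X) Y + (q : ℝ) • β X Y := by
      have h1 := hX.mdifferentiableAt x
      have h2 := (hL.isRadSection_tangentialJ hX).mdifferentiableAt x
      have h3 (c : ℝ) {Z : Π x : M, TangentSpace (𝓡 m) x} (hZ : MDifferentiableAt (𝓡 m)
          (𝓡 m).tangent (fun y ↦ (⟨y, Z y⟩ : TangentBundle (𝓡 m) M)) x) :
          MDifferentiableAt (𝓡 m) (𝓡 m).tangent
            (fun y ↦ (⟨y, (c • Z) y⟩ : TangentBundle (𝓡 m) M)) x :=
        (mdifferentiableAt_const (c := c)).smul_section hZ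
      simp only [β]
      rw [hL.tangentialJ_tangentialJ hX, mlieBracket_add_left (h3 _ h2) (h3 _ h1),
        mlieBracket_const_smul_left h2, mlieBracket_const_smul_left h1, map_add, map_smul, map_smul]
    have e1 := key hU hV
    -- Expanding J² on both sides yields 2p `β` (JU) (JV), which cancels the right-hand side; what
    -- is left is q times the left-hand side of `e1`.
    have e2 := key hJU hJV
    rw [hleft hU, hswap _ (L.tangentialJ J (L.tangentialJ J V)), hleft hV,
      hswap _ (L.tangentialJ J U), hswap V] at e2
    have e3 : (2 * p * q : ℝ) • β U V = 0 := by
      linear_combination (norm := module) e2 - (q : ℝ) • e1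
    have hpq : (2 * p * q : ℝ) ≠ 0 := by positivity
    exact (L.projection_mlieBracket_eq_zero_iff U V x).1 ((smul_eq_zero.1 e3).resolve_left hpq)
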